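/- Let $q$ be a prime power, let $V$ be a vector space over $\mathbb F_q$ of dimension $n\ge 2$, and let $B$ be a non-degenerate symmetric bilinear form on $V$. For a subspace $C\le V$ let $C^\perp=\{v\in V\mid B(v,c)=0\text{ for all }c\in C\}$, and call $C$ self-orthogonal if $C\subseteq C^\perp$. Let $\sigma(V,B,k)$ be the number of $k$-dimensional self-orthogonal subspaces of $V$, and let $w$ be the Witt index of $(V,B)$, that is, the common dimension of all maximal self-orthogonal subspaces of $V$. The form $B$ is called alternating if $B(v,v)=0$ for all $v\in V$. The space $(V,B)$ is said to be of type - (P) if $q$ and $n$ are odd; - (H) if $q$ is odd, $n$ is even and $w=n/2$; - (E) if $q$ is odd, $n$ is even and $w=n/2-1$; - (N$_1$) if $q$ is even and $n$ is odd; - (N$_{0,a}$) if $q$ and $n$ are even and $B$ is alternating; - (N$_{0,na}$) if $q$ and $n$ are even and $B$ is not alternating. **Theorem.** Suppose that $(V,B)$ is not of type (N$_{0,na}$), and let $1\le k\le w$. Then $(V,B)$ is of one of the types (P), (H), (E), (N$_{0,a}$), (N$_1$), and $$\sigma(V,B,k)=\sigma(V,B,k-1)\,Q,\qquad Q=\begin{cases}\dfrac{(q^{w-k+1}-1)(q^{n-k-w}+1)}{q^k-1}&\text{if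 the type is (P), (H) or (E)},\\[2ex] \dfrac{q^{n-2k+2}-1}{q^k-1}&\text{if the type is (N}_{0,a}),\\[2ex] \dfrac{q^{n-2k+1}-1}{q^k-1}&\text{if the type is (N}_1).\end{cases}$$ -/

import Mathlib

namespace BilinSpace

open Module

variable {K V : Type*} [Field K] [AddCommGroup V] [Module K V]

/-- A subspace `C` is `ℓ`-complementary if its radical `C ∩ C^⊥` has dimension `ℓ`. -/
def IsComplementary (B : LinearMap.BilinForm K V) (l : ℕ) (C : Submodule K V) : Prop :=
  finrank K (C ⊓ B.orthogonal C : Submodule K V) = l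

/-- A subspace `C` is self-orthogonal (totally isotropic) if `C ⊆ C^⊥`. -/
def IsSelfOrthogonal (B : LinearMap.BilinForm K V) (C : Submodule K V) : Prop :=
  C ≤ B.orthogonal C

/-- Self-orthogonal means `k`-complementary, where `k = dim C`. -/
theorem isSelfOrthogonal_iff [FiniteDimensional K V] (B : LinearMap.BilinForm K V)
    (C : Submodule K V) : IsSelfOrthogonal B C ↔ IsComplementary B (finrank K C) C := by
  unfold IsSelfOrthogonal IsComplementary
  constructor
  · intro h
    rw [inf_eq_left.mpr h]
  · intro h
    exact inf_eq_left.mp (Submodule.eq_of_le_of_finrank_eq inf_le_left h)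

/-- The set of the `ℓ`-complementary subspaces of dimension `k`. -/
def complementarySet (B : LinearMap.BilinForm K V) (k l : ℕ) : Set (Submodule K V) :=
  {C | finrank K C = k ∧ IsComplementary B l C}

/-- The number `σ(V,B,k,ℓ)` of `ℓ`-complementary subspaces of dimension `k`. -/
noncomputable def sigmaCompl (B : LinearMap.BilinForm K V) (k l : ℕ) : ℕ :=
  (complementarySet B k l).ncard

/-- The number `σ(V,B,k)` of self-orthogonal subspaces of dimension `k`. -/
noncomputable def sigma (B : LinearMap.BilinForm K V) (k : ℕ) : ℕ :=
  sigmaCompl B k k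

/-- The Witt index: the dimension of the maximal self-orthogonal subspaces
(they all have the same dimension, see `finrank_eq_wittIndex`). -/
noncomputable def wittIndex (B : LinearMap.BilinForm K V) : ℕ :=
  sSup {d | ∃ U : Submodule K V, Maximal (IsSelfOrthogonal B) U ∧ finrank K U = d}

/-- All maximal self-orthogonal subspaces have the same dimension. -/
theorem finrank_eq_of_maximal [FiniteDimensional K V] {B : LinearMap.BilinForm K V}
    (hs : B.IsSymm) (hB : B.Nondegenerate) {U W : Submodule K V}
    (hU : Maximal (IsSelfOrthogonal B) U) (hW : Maximal (IsSelfOrthogonal B) W) :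
    finrank K U = finrank K W := by
  have key : ∀ U W : Submodule K V, Maximal (IsSelfOrthogonal B) U → IsSelfOrthogonal B W →
      W ⊓ B.orthogonal U ≤ W ⊓ U := by
    intro U W hU hW
    refine le_inf inf_le_left ?_
    have h : IsSelfOrthogonal B (U ⊔ (W ⊓ B.orthogonal U)) := by
      intro x hx y hy
      obtain ⟨a, ha, b, hb, rfl⟩ := Submodule.mem_sup.mp hx
      obtain ⟨c, hc, d, hd, rfl⟩ := Submodule.mem_sup.mp hy
      have h1 : B c a = 0 := hU.prop ha c hc
      have h2 : B c b = 0 := hb.2 c hc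
      have h3 : B d a = 0 := by
        have : B a d = 0 := hd.2 a ha
        rwa [hs.eq a d] at this
      have h4 : B d b = 0 := hW hb.1 d hd.1
      simp [h1, h2, h3, h4]
    exact le_sup_right.trans (hU.le_of_ge h le_sup_left)
  have ineq : ∀ U W : Submodule K V, Maximal (IsSelfOrthogonal B) U →
      Maximal (IsSelfOrthogonal B) W → finrank K W ≤ finrank K U := by
    intro U W hU hW
    have e1 := Submodule.finrank_sup_add_finrank_inf_eq (B.orthogonal W) U
    have e2 := LinearMap.BilinForm.finrank_orthogonal hB W
    have e3 := LinearMap.BilinForm.finrank_orthogonal hB (B.orthogonal W ⊔ U)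
    have e4 : finrank K (B.orthogonal (B.orthogonal W ⊔ U)) ≤
        finrank K (W ⊓ U : Submodule K V) := by
      refine Submodule.finrank_mono (le_trans ?_ (key U W hU hW.prop))
      refine le_inf ?_ (LinearMap.BilinForm.orthogonal_le le_sup_right)
      refine (LinearMap.BilinForm.orthogonal_le le_sup_left).trans ?_
      rw [LinearMap.BilinForm.orthogonal_orthogonal hB hs.isRefl]
    have e5 : finrank K (W ⊓ U : Submodule K V) ≤
        finrank K (B.orthogonal W ⊓ U : Submodule K V) :=
      Submodule.finrank_mono (inf_le_inf_right _ hW.prop)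
    have e6 := Submodule.finrank_le W
    have e7 := Submodule.finrank_le (B.orthogonal W ⊔ U)
    omega
  exact le_antisymm (ineq W U hW hU) (ineq U W hU hW)

/-- The Witt index is the common dimension of the maximal self-orthogonal subspaces. -/
theorem finrank_eq_wittIndex [FiniteDimensional K V] {B : LinearMap.BilinForm K V}
    (hs : B.IsSymm) (hB : B.Nondegenerate) {U : Submodule K V}
    (hU : Maximal (IsSelfOrthogonal B) U) : finrank K U = wittIndex B := by
  have h : {d | ∃ U : Submodule K V, Maximal (IsSelfOrthogonal B) U ∧ finrank K U = d} =
      {finrank K U} := by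
    ext d
    constructor
    · rintro ⟨W, hW, rfl⟩
      exact finrank_eq_of_maximal hs hB hW hU
    · rintro rfl
      exact ⟨U, hU, rfl⟩
  rw [wittIndex, h, csSup_singleton]

/-- Maximal self-orthogonal subspaces exist. -/
theorem exists_maximal [FiniteDimensional K V] (B : LinearMap.BilinForm K V)
    {C : Submodule K V} (hC : IsSelfOrthogonal B C) :
    ∃ U : Submodule K V, C ≤ U ∧ Maximal (IsSelfOrthogonal B) U := by
  obtain ⟨U, hU, hmax⟩ := (wellFounded_gt (α := Submodule K V)).has_min
    {U : Submodule K V | C ≤ U ∧ IsSelfOrthogonal B U} ⟨C, le_rfl, hC⟩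
  refine ⟨U, hU.1, hU.2, fun W hW hUW => ?_⟩
  by_contra hne
  exact hmax W ⟨hU.1.trans hUW, hW⟩ (lt_of_le_not_ge hUW hne)

/-- Twice the Witt index is at most the dimension. -/
theorem two_mul_wittIndex_le [FiniteDimensional K V] {B : LinearMap.BilinForm K V}
    (hs : B.IsSymm) (hB : B.Nondegenerate) : 2 * wittIndex B ≤ finrank K V := by
  obtain ⟨U, -, hU⟩ := exists_maximal B (C := ⊥) bot_le
  have e := LinearMap.BilinForm.finrank_orthogonal hB U
  have h : finrank K U ≤ finrank K (B.orthogonal U) := Submodule.finrank_mono hU.prop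
  have h' := Submodule.finrank_le U
  rw [← finrank_eq_wittIndex hs hB hU]
  omega

/-! The types of a bilinear space `(V,B)` over the finite field `K` of order `q`,
with `n = dim V`. -/

/-- Type (P), parabolic: `q` odd and `n` odd. -/
def IsTypeP (_B : LinearMap.BilinForm K V) : Prop :=
  Odd (Nat.card K) ∧ Odd (finrank K V)

/-- Type (H), hyperbolic: `q` odd, `n` even, Witt index `n/2`. -/
def IsTypeH (B : LinearMap.BilinForm K V) : Prop :=
  Odd (Nat.card K) ∧ Even (finrank K V) ∧ 2 * wittIndex B = finrank K V

/-- Type (E), elliptic: `q` odd, `n` even, Witt index `n/2 - 1`. -/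
def IsTypeE (B : LinearMap.BilinForm K V) : Prop :=
  Odd (Nat.card K) ∧ Even (finrank K V) ∧ 2 * (wittIndex B + 1) = finrank K V

/-- Type (N₁): `q` even and `n` odd. -/
def IsTypeN1 (_B : LinearMap.BilinForm K V) : Prop :=
  Even (Nat.card K) ∧ Odd (finrank K V)

/-- Type (N₀,a): `q` even, `n` even and `B` alternating. -/
def IsTypeN0a (B : LinearMap.BilinForm K V) : Prop :=
  Even (Nat.card K) ∧ Even (finrank K V) ∧ B.IsAlt

/-- Type (N₀,na): `q` even, `n` even and `B` not alternating. -/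
def IsTypeN0na (B : LinearMap.BilinForm K V) : Prop :=
  Even (Nat.card K) ∧ Even (finrank K V) ∧ ¬ B.IsAlt

end BilinSpace

namespace BilinSpace

open Module

/-! Put `k = j + 1` and count pairs `(C, v)` with `C` self-orthogonal of dimension `j` and `v`
isotropic in `C^⊥` outside `C`. Sending the pair to `C + ⟨v⟩` hits each self-orthogonal `D` of
dimension `j + 1` as often as `D` has pairs of a hyperplane and a vector off it, namely `(q^(j+1) -
1) q^j` times (`sigma_succ_mul`). So it suffices that the number of isotropic vectors in `C^⊥`
depends on `j` only; `sigma_eq_mul_div` then gives the recursion.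

If `B` is alternating this number is `|C^⊥| = q^(n-j)`. If `q` is even and `n` odd, `v ↦ B v v` is
additive and onto on `C^⊥`, which gives `q^(n-j-1)`. If `q` is odd, cutting `C^⊥` into cosets of a
maximal self-orthogonal `U ⊇ C` gives `q^w + (q^(n-j) - q^(n-w)) / q`.

The classification into types needs `n ≤ 2w + 2` for odd `q`: a ternary quadratic form over a finite
field has a nontrivial zero. -/

/-! ### Counting by fibres -/

theorem ncard_eq_ncard_mul_of_fibers {α β : Type*} [Finite α] [Finite β] {s : Set α} {t : Set β}
    (f : α → β) (m : ℕ) (hst : Set.MapsTo f s t)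
    (hm : ∀ b ∈ t, {a | a ∈ s ∧ f a = b}.ncard = m) : s.ncard = t.ncard * m := by
  classical
  have := Fintype.ofFinite α
  have := Fintype.ofFinite β
  rw [Set.ncard_eq_toFinset_card' s, Set.ncard_eq_toFinset_card' t,
    Finset.card_eq_sum_card_fiberwise (f := f) (t := t.toFinset) (by simpa using hst)]
  refine Finset.sum_const_nat fun b hb => ?_
  rw [← hm b (by simpa using hb), Set.ncard_eq_toFinset_card']
  congr 1
  ext a
  simp

theorem card_mul_ncard_fiber {A G : Type*} [AddGroup A] [AddGroup G] [Finite A] [Finite G]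
    (φ : A →+ G) (hφ : Function.Surjective φ) (c : G) :
    Nat.card G * {a | φ a = c}.ncard = Nat.card A := by
  have h := ncard_eq_ncard_mul_of_fibers (s := Set.univ) (t := Set.univ) φ {a | φ a = c}.ncard
    (Set.mapsTo_univ _ _) (fun b _ => ?_)
  · rw [Set.ncard_univ, Set.ncard_univ] at h
    exact h.symm
  -- Translation by `a₀` carries the fibre over `b` onto the fibre over `c`.
  · obtain ⟨a₀, ha₀⟩ := hφ (c - b)
    rw [← Set.ncard_image_of_injective _ (add_right_injective a₀)]
    congr 1
    ext a
    simp only [Set.mem_univ, true_and, Set.mem_image, Set.mem_ofPred_eq]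
    constructor
    · rintro ⟨x, hx, rfl⟩
      simp [ha₀, hx]
    · intro h
      exact ⟨-a₀ + a, by simp [ha₀, h], by simp⟩

variable {K V : Type*} [Field K] [AddCommGroup V] [Module K V]

theorem card_mul_ncard_dual_fiber [Finite K] [Finite V] {f : V →ₗ[K] K} (hf : f ≠ 0) (c : K) :
    Nat.card K * {x | f x = c}.ncard = Nat.card V :=
  card_mul_ncard_fiber f.toAddMonoidHom (LinearMap.surjective hf) c

theorem ncard_coe_submodule [Finite K] [FiniteDimensional K V] (C : Submodule K V) :
    (C : Set V).ncard = Nat.card K ^ finrank K C := by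
  rw [← Module.natCard_eq_pow_finrank (K := K) (V := C)]
  rfl

/-! ### Hyperplanes together with a vector outside -/

/-- Each nonzero functional takes the value `1` on an affine hyperplane. Counting pairs avoids a
division by `q - 1`. -/
theorem ncard_dual_apply_eq_one [Finite K] [FiniteDimensional K V] (hV : 1 ≤ finrank K V) :
    {p : Dual K V × V | p.1 p.2 = 1}.ncard =
      (Nat.card K ^ finrank K V - 1) * Nat.card K ^ (finrank K V - 1) := by
  have : Finite V := Module.finite_of_finite K
  have : Finite (Dual K V) := Module.finite_of_finite K
  rw [ncard_eq_ncard_mul_of_fibers (t := {0}ᶜ) Prod.fst (Nat.card K ^ (finrank K V - 1))]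
  · congr 1
    rw [Set.ncard_compl, Set.ncard_singleton, Module.natCard_eq_pow_finrank (K := K),
      Subspace.dual_finrank_eq]
  · rintro ⟨f, x⟩ h
    rw [Set.mem_compl_singleton_iff]
    rintro (rfl : f = 0)
    simp at h
  · intro f hf
    have e := card_mul_ncard_dual_fiber (f := f) hf 1
    have : {a : Dual K V × V | a ∈ {p : Dual K V × V | p.1 p.2 = 1} ∧ a.1 = f} =
        (Prod.mk f) '' {x | f x = 1} := by
      ext ⟨g, x⟩
      simp only [Set.mem_ofPred_eq, Set.mem_image, Prod.mk.injEq, exists_eq_right_right]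
      constructor
      · rintro ⟨h, rfl⟩
        exact ⟨h, rfl⟩
      · rintro ⟨h, rfl⟩
        exact ⟨h, rfl⟩
    rw [this, Set.ncard_image_of_injective _ (Prod.mk_right_injective f)]
    rw [Module.natCard_eq_pow_finrank (K := K) (V := V)] at e
    refine Nat.eq_of_mul_eq_mul_left (Nat.card_pos (α := K)) (e.trans ?_)
    rw [← pow_succ', Nat.sub_add_cancel hV]

/-- Pairs of a hyperplane and a vector off it correspond to pairs of a functional and a vector
on which it takes the value `1`. -/
theorem ncard_hyperplane_notMem [Finite K] [FiniteDimensional K V] (hV : 1 ≤ finrank K V) :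
    {p : Submodule K V × V | finrank K p.1 + 1 = finrank K V ∧ p.2 ∉ p.1}.ncard =
      (Nat.card K ^ finrank K V - 1) * Nat.card K ^ (finrank K V - 1) := by
  rw [← ncard_dual_apply_eq_one hV]
  symm
  refine Set.ncard_congr (fun p _ => (LinearMap.ker p.1, p.2)) ?_ ?_ ?_
  · rintro ⟨f, x⟩ (h : f x = 1)
    have hf : f ≠ 0 := by
      rintro rfl
      simp at h
    have := LinearMap.finrank_range_add_finrank_ker f
    rw [LinearMap.range_eq_top.mpr (LinearMap.surjective hf), finrank_top, finrank_self] at this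
    exact ⟨by simp only; omega, by simp [h]⟩
  · rintro ⟨f, x⟩ ⟨g, y⟩ (hf : f x = 1) (hg : g y = 1) h
    obtain ⟨hk, rfl⟩ := Prod.mk.inj h
    refine Prod.ext (LinearMap.ext fun z => ?_) rfl
    -- A functional is determined by its kernel and its value at one vector off the kernel.
    have hz : z - f z • x ∈ LinearMap.ker f := by simp [hf]
    rw [hk] at hz
    have : g z - f z * g x = 0 := by simpa using hz
    rw [hg, mul_one, sub_eq_zero] at this
    exact this.symm
  · rintro ⟨C, x⟩ ⟨hC, hx⟩
    obtain ⟨f, hfx, hf⟩ := Submodule.exists_le_ker_of_notMem hx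
    simp only at hC hx hf hfx
    have hg : ((f x)⁻¹ • f) x = 1 := by simp [hfx]
    refine ⟨((f x)⁻¹ • f, x), hg, Prod.ext ?_ rfl⟩
    have hle : C ≤ LinearMap.ker ((f x)⁻¹ • f) := fun y hy => by
      have : f y = 0 := hf hy
      simp [this]
    refine (Submodule.eq_of_le_of_finrank_le hle ?_).symm
    have : finrank K (LinearMap.ker ((f x)⁻¹ • f)) < finrank K V := by
      refine Submodule.finrank_lt fun ht => ?_
      have : x ∈ LinearMap.ker ((f x)⁻¹ • f) := ht ▸ Submodule.mem_top
      rw [LinearMap.mem_ker, hg] at this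
      exact one_ne_zero this
    omega

theorem ncard_hyperplane_notMem_submodule [Finite K] [FiniteDimensional K V] (D : Submodule K V)
    (hD : 1 ≤ finrank K D) :
    {p : Submodule K V × V | p.1 ≤ D ∧ finrank K p.1 + 1 = finrank K D ∧ p.2 ∈ D ∧
      p.2 ∉ p.1}.ncard = (Nat.card K ^ finrank K D - 1) * Nat.card K ^ (finrank K D - 1) := by
  rw [← ncard_hyperplane_notMem hD]
  symm
  refine Set.ncard_congr (fun p _ => (p.1.map D.subtype, (p.2 : V))) ?_ ?_ ?_
  · rintro ⟨C, x⟩ ⟨hC, hx⟩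
    refine ⟨Submodule.map_subtype_le D C, ?_, x.2, ?_⟩
    · simpa [Submodule.finrank_map_subtype_eq] using hC
    · simpa using hx
  · rintro ⟨C, x⟩ ⟨C', x'⟩ - - h
    obtain ⟨h1, h2⟩ := Prod.mk.inj h
    exact Prod.ext (Submodule.map_injective_of_injective D.injective_subtype h1) (Subtype.ext h2)
  · rintro ⟨C, x⟩ ⟨hCD, hC, hxD, hx⟩
    simp only at hCD hC hxD hx
    have e : (C.comap D.subtype).map D.subtype = C := by
      rw [Submodule.map_comap_subtype, inf_eq_right.mpr hCD]
    refine ⟨(C.comap D.subtype, ⟨x, hxD⟩), ⟨?_, by simpa using hx⟩, Prod.ext e rfl⟩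
    rw [← hC, ← Submodule.finrank_map_subtype_eq, e]

/-! ### Extending self-orthogonal subspaces by one vector -/

theorem mem_complementarySet_self [FiniteDimensional K V] {B : LinearMap.BilinForm K V} {k : ℕ}
    {C : Submodule K V} :
    C ∈ complementarySet B k k ↔ IsSelfOrthogonal B C ∧ finrank K C = k := by
  rw [isSelfOrthogonal_iff]
  constructor
  · rintro ⟨rfl, h⟩
    exact ⟨h, rfl⟩
  · rintro ⟨h, rfl⟩
    exact ⟨rfl, h⟩

theorem IsSelfOrthogonal.sup_span_singleton {B : LinearMap.BilinForm K V} (hs : B.IsSymm)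
    {C : Submodule K V} (hC : IsSelfOrthogonal B C) {v : V} (hv : v ∈ B.orthogonal C)
    (hvv : B v v = 0) : IsSelfOrthogonal B (C ⊔ K ∙ v) := by
  intro x hx y hy
  obtain ⟨a, ha, b, hb, rfl⟩ := Submodule.mem_sup.mp hx
  obtain ⟨c, hc, d, hd, rfl⟩ := Submodule.mem_sup.mp hy
  obtain ⟨s, rfl⟩ := Submodule.mem_span_singleton.mp hb
  obtain ⟨t, rfl⟩ := Submodule.mem_span_singleton.mp hd
  have h1 : B c a = 0 := hC ha c hc
  have h2 : B c v = 0 := hv c hc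
  have h3 : B v a = 0 := by
    have : B a v = 0 := hv a ha
    rwa [hs.eq a v] at this
  simp [h1, h2, h3, hvv]

/-- A maximal self-orthogonal subspace contains the isotropic vectors orthogonal to it. -/
theorem mem_of_maximal {B : LinearMap.BilinForm K V} (hs : B.IsSymm) {U : Submodule K V}
    (hU : Maximal (IsSelfOrthogonal B) U) {v : V} (hv : v ∈ B.orthogonal U) (hvv : B v v = 0) :
    v ∈ U :=
  hU.le_of_ge (hU.prop.sup_span_singleton hs hv hvv) le_sup_left
    (Submodule.mem_sup_right (Submodule.mem_span_singleton_self v))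

/-- Double counting of the pairs of a `j`-dimensional self-orthogonal subspace and a vector
extending it to a self-orthogonal subspace of dimension `j + 1`. -/
theorem sigma_succ_mul [Finite K] [FiniteDimensional K V] {B : LinearMap.BilinForm K V}
    (hs : B.IsSymm) {j M : ℕ}
    (hM : ∀ C, IsSelfOrthogonal B C → finrank K C = j →
      {v | v ∈ B.orthogonal C ∧ B v v = 0 ∧ v ∉ C}.ncard = M) :
    sigma B (j + 1) * ((Nat.card K ^ (j + 1) - 1) * Nat.card K ^ j) = sigma B j * M := by
  have : Finite V := Module.finite_of_finite K
  let P : Set (Submodule K V × V) := {p | p.1 ∈ complementarySet B j j ∧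
    p.2 ∈ B.orthogonal p.1 ∧ B p.2 p.2 = 0 ∧ p.2 ∉ p.1}
  have hfin : ∀ {C : Submodule K V} {v : V}, v ∉ C →
      finrank K (C ⊔ K ∙ v : Submodule K V) = finrank K C + 1 := by
    intro C v hv
    have h0 : v ≠ 0 := by
      rintro rfl
      exact hv C.zero_mem
    have h := Submodule.finrank_sup_add_finrank_inf_eq C (K ∙ v)
    rw [((Submodule.disjoint_span_singleton' h0).mpr hv).eq_bot, finrank_bot,
      finrank_span_singleton h0] at h
    simpa using h
  have e1 : P.ncard = (complementarySet B j j).ncard * M := by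
    refine ncard_eq_ncard_mul_of_fibers Prod.fst M (fun p hp => hp.1) fun C hC => ?_
    obtain ⟨hC1, hC2⟩ := mem_complementarySet_self.mp hC
    rw [← hM C hC1 hC2, ← Set.ncard_image_of_injective _ (Prod.mk_right_injective (β := V) C)]
    congr 1
    ext ⟨C', v⟩
    constructor
    · rintro ⟨⟨-, h⟩, rfl⟩
      exact ⟨v, h, rfl⟩
    · rintro ⟨v', h, h'⟩
      obtain ⟨rfl, rfl⟩ := Prod.mk.inj h'
      exact ⟨⟨hC, h⟩, rfl⟩
  have e2 : P.ncard = (complementarySet B (j + 1) (j + 1)).ncard *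
      ((Nat.card K ^ (j + 1) - 1) * Nat.card K ^ j) := by
    refine ncard_eq_ncard_mul_of_fibers (fun p => p.1 ⊔ K ∙ p.2) _ ?_ fun D hD => ?_
    · rintro ⟨C, v⟩ ⟨hC, hv, hvv, hvC⟩
      obtain ⟨hC1, hC2⟩ := mem_complementarySet_self.mp hC
      exact mem_complementarySet_self.mpr
        ⟨hC1.sup_span_singleton hs hv hvv, by rw [hfin hvC, hC2]⟩
    · obtain ⟨hD1, hD2⟩ := mem_complementarySet_self.mp hD
      have h := ncard_hyperplane_notMem_submodule D (by omega)
      rw [hD2, Nat.add_sub_cancel] at h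
      rw [← h]
      congr 1
      ext ⟨C, v⟩
      constructor
      · rintro ⟨⟨hC, hv, hvv, hvC⟩, rfl⟩
        obtain ⟨hC1, hC2⟩ := mem_complementarySet_self.mp hC
        exact ⟨le_sup_left, by simpa using hC2,
          Submodule.mem_sup_right (Submodule.mem_span_singleton_self v), hvC⟩
      · rintro ⟨hCD, hC, hvD, hvC⟩
        simp only at hCD hC hvD hvC
        have hC1 : IsSelfOrthogonal B C :=
          hCD.trans (hD1.trans (LinearMap.BilinForm.orthogonal_le hCD))
        refine ⟨⟨mem_complementarySet_self.mpr ⟨hC1, by simpa using hC⟩,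
          fun c hc => hD1 hvD c (hCD hc), hD1 hvD v hvD, hvC⟩, ?_⟩
        refine Submodule.eq_of_le_of_finrank_eq
          (sup_le hCD ((Submodule.span_singleton_le_iff_mem _ _).mpr hvD)) ?_
        rw [hfin hvC, hD2, hC]
  exact e2.symm.trans e1

/-! ### Isotropic vectors in `C^⊥` -/

theorem ncard_isotropic_notMem [Finite K] [FiniteDimensional K V] {B : LinearMap.BilinForm K V}
    {C : Submodule K V} (hC : IsSelfOrthogonal B C) :
    {v | v ∈ B.orthogonal C ∧ B v v = 0 ∧ v ∉ C}.ncard + Nat.card K ^ finrank K C =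
      {v | v ∈ B.orthogonal C ∧ B v v = 0}.ncard := by
  have : Finite V := Module.finite_of_finite K
  rw [← ncard_coe_submodule, ← Set.ncard_sdiff_add_ncard_of_subset (s := (C : Set V))
    (t := {v | v ∈ B.orthogonal C ∧ B v v = 0})]
  · congr 2
    ext v
    simp [and_assoc]
  · exact fun v hv => ⟨hC hv, hC hv v hv⟩

theorem ncard_orthogonal [Finite K] [FiniteDimensional K V] {B : LinearMap.BilinForm K V}
    (hB : B.Nondegenerate) (C : Submodule K V) :
    (B.orthogonal C : Set V).ncard = Nat.card K ^ (finrank K V - finrank K C) := by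
  rw [ncard_coe_submodule, LinearMap.BilinForm.finrank_orthogonal hB]

/-- For a maximal `U ⊇ C`, all of `U^⊥ ⊆ C^⊥` is isotropic, so maximality forces `U^⊥ = U` and `n =
2 dim U`. -/
theorem finrank_eq_two_mul_of_isotropic [FiniteDimensional K V] {B : LinearMap.BilinForm K V}
    (hs : B.IsSymm) (hB : B.Nondegenerate) {C : Submodule K V} (hC : IsSelfOrthogonal B C)
    (h : ∀ v ∈ B.orthogonal C, B v v = 0) : Even (finrank K V) := by
  obtain ⟨U, hCU, hU⟩ := exists_maximal B hC
  have hle : B.orthogonal U ≤ U := fun v hv =>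
    mem_of_maximal hs hU hv (h v (LinearMap.BilinForm.orthogonal_le hCU hv))
  have e := LinearMap.BilinForm.finrank_orthogonal hB U
  rw [le_antisymm hle hU.prop] at e
  have := Submodule.finrank_le U
  exact ⟨finrank K U, by omega⟩

theorem two_eq_zero_of_even_card [Finite K] (h : Even (Nat.card K)) : (2 : K) = 0 := by
  have := Fintype.ofFinite K
  rw [Nat.card_eq_fintype_card, Nat.even_iff, ← FiniteField.even_card_iff_char_two] at h
  have := ringChar.of_eq h
  exact CharTwo.two_eq_zero

theorem two_ne_zero_of_odd_card [Finite K] (h : Odd (Nat.card K)) : (2 : K) ≠ 0 := by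
  have := Fintype.ofFinite K
  refine Ring.two_ne_zero fun h2 => ?_
  rw [FiniteField.even_card_iff_char_two, ← Nat.even_iff, ← Nat.card_eq_fintype_card] at h2
  exact Nat.not_even_iff_odd.mpr h h2

/-- In even characteristic `v ↦ B v v` is additive, so the isotropic vectors of `C^⊥` are
`1/q` of all its vectors unless they are all isotropic. -/
theorem ncard_isotropic_of_even [Finite K] [FiniteDimensional K V] {B : LinearMap.BilinForm K V}
    (hs : B.IsSymm) (hB : B.Nondegenerate) (hK : Even (Nat.card K)) (hV : Odd (finrank K V))
    {C : Submodule K V} (hC : IsSelfOrthogonal B C) :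
    Nat.card K * {v | v ∈ B.orthogonal C ∧ B v v = 0}.ncard =
      Nat.card K ^ (finrank K V - finrank K C) := by
  have : Finite V := Module.finite_of_finite K
  have := Fintype.ofFinite K
  have h2 : (2 : K) = 0 := two_eq_zero_of_even_card hK
  let φ : B.orthogonal C →+ K :=
    { toFun := fun v => B v v
      map_zero' := by simp
      map_add' := fun x y => by
        have : B (y : V) x = B x y := hs.eq y x
        simp only [Submodule.coe_add, map_add, LinearMap.add_apply, this]
        linear_combination B x y * h2 }
  have hφ : Function.Surjective φ := by
    obtain ⟨v, hv, hvv⟩ : ∃ v ∈ B.orthogonal C, B v v ≠ 0 := by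
      by_contra! h
      exact Nat.not_even_iff_odd.mpr hV (finrank_eq_two_mul_of_isotropic hs hB hC h)
    intro c
    rw [Nat.card_eq_fintype_card, Nat.even_iff, ← FiniteField.even_card_iff_char_two] at hK
    -- Scaling `v` by `a` multiplies `B v v` by `a²`, and in characteristic two every element is a
    -- square.
    obtain ⟨a, ha⟩ := FiniteField.isSquare_of_char_two hK (c / B v v)
    refine ⟨a • ⟨v, hv⟩, ?_⟩
    change B (a • v) (a • v) = c
    rw [map_smul, map_smul, LinearMap.smul_apply, smul_eq_mul, smul_eq_mul, ← mul_assoc, ← ha,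
      div_mul_cancel₀ _ hvv]
  have h := card_mul_ncard_fiber φ hφ 0
  rw [← Set.ncard_image_of_injective _ Subtype.val_injective,
    Module.natCard_eq_pow_finrank (K := K) (V := B.orthogonal C), LinearMap.BilinForm.finrank_orthogonal hB] at h
  rw [← h]
  congr 2
  ext v
  simp only [Set.mem_image, Set.mem_ofPred_eq, Subtype.exists, exists_and_right, exists_eq_right]
  exact ⟨fun h => ⟨h.1, h.2⟩, fun ⟨h, h'⟩ => ⟨h, h'⟩⟩

/-- In odd characteristic, a coset of a maximal self-orthogonal `U` that is not orthogonal to `U`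
contains exactly `|U| / q` isotropic vectors, one in `U^⊥` contains none unless it is `U`. -/
theorem ncard_isotropic_of_odd [Finite K] [FiniteDimensional K V] {B : LinearMap.BilinForm K V}
    (hs : B.IsSymm) (hB : B.Nondegenerate) (hK : Odd (Nat.card K))
    {C U : Submodule K V} (hCU : C ≤ U) (hU : Maximal (IsSelfOrthogonal B) U) :
    Nat.card K * {v | v ∈ B.orthogonal C ∧ B v v = 0}.ncard +
        Nat.card K ^ (finrank K V - finrank K U) =
      Nat.card K * Nat.card K ^ finrank K U + Nat.card K ^ (finrank K V - finrank K C) := by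
  have : Finite V := Module.finite_of_finite K
  have h2 : (2 : K) ≠ 0 := two_ne_zero_of_odd_card hK
  have hUC : B.orthogonal U ≤ B.orthogonal C := LinearMap.BilinForm.orthogonal_le hCU
  let X : Set V := {v | v ∈ B.orthogonal C ∧ v ∉ B.orthogonal U}
  let Y : Set V := {v | v ∈ X ∧ B v v = 0}
  have hX : X.ncard + Nat.card K ^ (finrank K V - finrank K U) =
      Nat.card K ^ (finrank K V - finrank K C) := by
    rw [← ncard_orthogonal hB, ← ncard_orthogonal hB]
    exact Set.ncard_sdiff_add_ncard_of_subset hUC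
  have hY : Y.ncard + Nat.card K ^ finrank K U =
      {v | v ∈ B.orthogonal C ∧ B v v = 0}.ncard := by
    rw [← ncard_coe_submodule, ← Set.ncard_sdiff_add_ncard_of_subset (s := (U : Set V))
      (t := {v | v ∈ B.orthogonal C ∧ B v v = 0})]
    · congr 2
      ext v
      constructor
      · rintro ⟨⟨h1, h3⟩, h4⟩
        exact ⟨⟨h1, h4⟩, fun h => h3 (hU.prop h)⟩
      · rintro ⟨⟨h1, h3⟩, h4⟩
        exact ⟨⟨h1, fun h => h4 (mem_of_maximal hs hU h h3)⟩, h3⟩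
    · exact fun v hv => ⟨hUC (hU.prop hv), hU.prop hv v hv⟩
  have hadd : ∀ x : V, ∀ u ∈ U, (x + u ∈ X ↔ x ∈ X) := by
    intro x u hu
    have hu' : u ∈ B.orthogonal U := hU.prop hu
    exact and_congr (Submodule.add_mem_iff_left _ (hUC hu'))
      (not_congr (Submodule.add_mem_iff_left _ hu'))
  -- `P` is counted twice: over `x` by the affine equation in `u`, and over the sum `x + u`, where
  -- each `y` comes from the pairs `(y - u, u)`.
  let P : Set (V × U) := {p | p.1 ∈ X ∧ B (p.1 + p.2) (p.1 + p.2) = 0}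
  have hfib : ∀ x ∈ X, Nat.card K * {u : U | B (x + u) (x + u) = 0}.ncard = Nat.card U := by
    intro x hx
    have hne : (B x).comp U.subtype ≠ 0 := by
      intro h
      refine hx.2 fun u hu => ?_
      have h' : B x u = 0 := LinearMap.congr_fun h ⟨u, hu⟩
      rwa [← hs.eq u x] at h'
    rw [← card_mul_ncard_dual_fiber hne (-(B x x) / 2)]
    congr 2
    ext u
    have h1 : B (u : V) x = B x u := hs.eq u x
    have h3 : B (u : V) u = 0 := hU.prop u.2 u u.2
    have h4 : B (x + u) (x + u) = B x x + 2 * B x u := by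
      simp only [map_add, LinearMap.add_apply, h1, h3]
      ring
    change B (x + u) (x + u) = 0 ↔ B x u = -(B x x) / 2
    rw [h4, eq_div_iff h2, add_comm, add_eq_zero_iff_eq_neg, mul_comm]
  -- The quotient is exact as soon as `X` is nonempty.
  obtain ⟨m, hm⟩ : ∃ m, ∀ x ∈ X, {u : U | B (x + u) (x + u) = 0}.ncard = m :=
    ⟨Nat.card U / Nat.card K, fun x hx =>
      (Nat.div_eq_of_eq_mul_right Nat.card_pos (hfib x hx).symm).symm⟩
  have e1 : P.ncard = X.ncard * m := by
    refine ncard_eq_ncard_mul_of_fibers Prod.fst m (fun p hp => hp.1) fun x hx => ?_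
    rw [← hm x hx, ← Set.ncard_image_of_injective _ (Prod.mk_right_injective (β := U) x)]
    congr 1
    ext ⟨x', u⟩
    constructor
    · rintro ⟨⟨-, h⟩, rfl⟩
      exact ⟨u, h, rfl⟩
    · rintro ⟨u', h, h'⟩
      obtain ⟨rfl, rfl⟩ := Prod.mk.inj h'
      exact ⟨⟨hx, h⟩, rfl⟩
  have e2 : P.ncard = Y.ncard * Nat.card U := by
    refine ncard_eq_ncard_mul_of_fibers (fun p : V × U => p.1 + (p.2 : V)) _
      (fun p (hp : p ∈ P) => ⟨(hadd _ _ p.2.2).mpr hp.1, hp.2⟩) fun y hy => ?_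
    rw [← Set.ncard_univ, ← Set.ncard_image_of_injective (f := fun u : U => (y - (u : V), u)) _
      fun u u' h => (Prod.mk.inj h).2]
    congr 1
    ext ⟨x, u⟩
    constructor
    · rintro ⟨-, h⟩
      exact ⟨u, Set.mem_univ _, by simp [← h]⟩
    · rintro ⟨u', -, h'⟩
      obtain ⟨rfl, rfl⟩ := Prod.mk.inj h'
      have h : y - (u' : V) + u' = y := sub_add_cancel _ _
      refine ⟨⟨(hadd _ _ u'.2).mp ?_, ?_⟩, h⟩
      · simpa only [h] using hy.1
      · simpa only [h] using hy.2
  have e3 : Nat.card K * Y.ncard = X.ncard := by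
    -- `X` is empty when `C = U`; then `hm` says nothing about `m`.
    rcases X.eq_empty_or_nonempty with hX0 | ⟨x, hx⟩
    · have : Y = ∅ := Set.eq_empty_of_forall_notMem fun y hy => by
        have := hy.1
        rw [hX0] at this
        exact this
      rw [this, hX0]
      simp
    · refine Nat.eq_of_mul_eq_mul_right (Nat.card_pos (α := U)) ?_
      have hx' := hfib x hx
      rw [hm x hx] at hx'
      rw [mul_assoc, ← e2, e1, ← hx']
      ring
  rw [← hY, mul_add, e3]
  omega

/-- Over a finite field of odd order, `U^⊥ / U` is anisotropic, hence of dimension at most two,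
if `U` is a maximal self-orthogonal subspace. -/
theorem finrank_le_two_mul_wittIndex_add_two [Finite K] [FiniteDimensional K V]
    {B : LinearMap.BilinForm K V} (hs : B.IsSymm) (hB : B.Nondegenerate)
    (hK : Odd (Nat.card K)) : finrank K V ≤ 2 * wittIndex B + 2 := by
  have := Fintype.ofFinite K
  obtain ⟨U, -, hU⟩ := exists_maximal B (C := ⊥) bot_le
  rw [← finrank_eq_wittIndex hs hB hU]
  by_contra! hlt
  -- Here `dim W^⊥ > dim U`, so `W^⊥` has a vector outside `U`; it lies in `U^⊥`, hence cannot be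
  -- isotropic.
  have hex : ∀ W : Submodule K V, finrank K W ≤ finrank K U + 2 →
      U ≤ W → ∃ v ∈ B.orthogonal W, B v v ≠ 0 := by
    intro W hW hUW
    have hnot : ¬ B.orthogonal W ≤ U := fun hle => by
      have := Submodule.finrank_mono hle
      rw [LinearMap.BilinForm.finrank_orthogonal hB] at this
      omega
    obtain ⟨v, hv, hvU⟩ := Set.not_subset.mp hnot
    exact ⟨v, hv, fun h =>
      hvU (mem_of_maximal hs hU (LinearMap.BilinForm.orthogonal_le hUW hv) h)⟩
  have hfin : ∀ (W : Submodule K V) (v : V),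
      finrank K (W ⊔ K ∙ v : Submodule K V) ≤ finrank K W + 1 := fun W v =>
    (Submodule.finrank_add_le_finrank_add_finrank W (K ∙ v)).trans
      (Nat.add_le_add_left ((finrank_span_le_card {v}).trans (by simp)) _)
  obtain ⟨x, hx, hxx⟩ := hex U (by omega) le_rfl
  obtain ⟨y, hy, hyy⟩ := hex (U ⊔ K ∙ x) ((hfin U x).trans (by omega)) le_sup_left
  obtain ⟨z, hz, hzz⟩ := hex (U ⊔ K ∙ x ⊔ K ∙ y)
    ((hfin _ y).trans (Nat.add_le_add_right (hfin U x) 1)) (le_sup_left.trans le_sup_left)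
  have hmem : ∀ v : V, v ∈ K ∙ v := Submodule.mem_span_singleton_self
  have hxy : B x y = 0 := hy x (Submodule.mem_sup_right (hmem x))
  have hxz : B x z = 0 := hz x (Submodule.mem_sup_left (Submodule.mem_sup_right (hmem x)))
  have hyz : B y z = 0 := hz y (Submodule.mem_sup_right (hmem y))
  have hyx : B y x = 0 := (hs.eq y x).trans hxy
  have hzx : B z x = 0 := (hs.eq z x).trans hxz
  have hzy : B z y = 0 := (hs.eq z y).trans hyz
  have hyU : y ∈ B.orthogonal U := LinearMap.BilinForm.orthogonal_le le_sup_left hy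
  have hzU : z ∈ B.orthogonal U :=
    LinearMap.BilinForm.orthogonal_le (le_sup_left.trans le_sup_left) hz
  -- This solves `a² B(x,x) + b² B(y,y) + B(z,z) = 0`; the constant term is placed in `f`.
  obtain ⟨a, b, hab⟩ := FiniteField.exists_root_sum_quadratic (R := K)
    (f := Polynomial.C (B x x) * Polynomial.X ^ 2 + Polynomial.C 0 * Polynomial.X +
      Polynomial.C (B z z))
    (g := Polynomial.C (B y y) * Polynomial.X ^ 2 + Polynomial.C 0 * Polynomial.X +
      Polynomial.C 0)
    (Polynomial.degree_quadratic hxx) (Polynomial.degree_quadratic hyy)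
    (by rwa [← Nat.card_eq_fintype_card, ← Nat.odd_iff])
  simp only [Polynomial.eval_add, Polynomial.eval_mul, Polynomial.eval_C, Polynomial.eval_pow,
    Polynomial.eval_X, zero_mul, add_zero] at hab
  have hv : a • x + b • y + z ∈ B.orthogonal U :=
    add_mem (add_mem (Submodule.smul_mem _ _ hx) (Submodule.smul_mem _ _ hyU)) hzU
  have hvU := mem_of_maximal hs hU hv (by
    simp only [map_add, map_smul, LinearMap.add_apply, LinearMap.smul_apply, smul_eq_mul, hxy,
      hyx, hxz, hzx, hyz, hzy]
    linear_combination hab)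
  -- The isotropic combination lies in `U` and `z` in `U^⊥`, yet their product is `B z z ≠ 0`.
  have : B (a • x + b • y + z) z = 0 := hzU _ hvU
  simp only [map_add, map_smul, LinearMap.add_apply, LinearMap.smul_apply, smul_eq_mul, hxz, hyz,
    mul_zero, zero_add] at this
  exact hzz this

/-! ### The recursion -/

/-- `Q` is the numerator of the final quotient: the `q^j` vectors of `C` itself account for the `+
1`, and the other `q^j Q` extend `C`. -/
theorem sigma_eq_mul_div [Finite K] [FiniteDimensional K V] {B : LinearMap.BilinForm K V}
    (hs : B.IsSymm) {j : ℕ} {Q : ℚ}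
    (hQ : ∀ C, IsSelfOrthogonal B C → finrank K C = j →
      ({v | v ∈ B.orthogonal C ∧ B v v = 0}.ncard : ℚ) = (Nat.card K : ℚ) ^ j * (Q + 1)) :
    (sigma B (j + 1) : ℚ) = sigma B j * (Q / ((Nat.card K : ℚ) ^ (j + 1) - 1)) := by
  have hq : 1 < Nat.card K := Finite.one_lt_card
  have hq' : (1 : ℚ) < Nat.card K := by exact_mod_cast hq
  have hpos : (0 : ℚ) < (Nat.card K : ℚ) ^ j := by positivity
  have hden : (0 : ℚ) < (Nat.card K : ℚ) ^ (j + 1) - 1 :=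
    sub_pos.mpr (one_lt_pow₀ hq' j.succ_ne_zero)
  have hcount : ∀ C, IsSelfOrthogonal B C → finrank K C = j →
      ({v | v ∈ B.orthogonal C ∧ B v v = 0 ∧ v ∉ C}.ncard : ℚ) = (Nat.card K : ℚ) ^ j * Q := by
    intro C hC hj
    have h := congrArg (Nat.cast (R := ℚ)) (ncard_isotropic_notMem hC)
    push_cast at h
    rw [hQ C hC hj, hj] at h
    linear_combination h
  have hmul : ∀ M : ℕ, (sigma B (j + 1) * ((Nat.card K ^ (j + 1) - 1) * Nat.card K ^ j) =
      sigma B j * M) → (sigma B (j + 1) : ℚ) * ((Nat.card K : ℚ) ^ (j + 1) - 1) *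
        (Nat.card K : ℚ) ^ j = sigma B j * M := by
    intro M h
    have h' := congrArg (Nat.cast (R := ℚ)) h
    rw [Nat.cast_mul, Nat.cast_mul, Nat.cast_sub (Nat.one_le_pow _ _ (by omega))] at h'
    push_cast at h'
    rw [mul_assoc, h']
  rw [mul_div_assoc', eq_div_iff hden.ne']
  refine mul_right_cancel₀ hpos.ne' ?_
  by_cases hex : ∃ C, IsSelfOrthogonal B C ∧ finrank K C = j
  · obtain ⟨C₀, hC₀, hj₀⟩ := hex
    rw [hmul _ (sigma_succ_mul hs fun C hC hj => Nat.cast_injective (R := ℚ)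
      ((hcount C hC hj).trans (hcount C₀ hC₀ hj₀).symm)), hcount C₀ hC₀ hj₀]
    ring
  -- With no `C` of dimension `j`, the count hypothesis is vacuous and `M = 0` serves.
  · have h0 : sigma B j = 0 := by
      have : complementarySet B j j = ∅ := Set.eq_empty_of_forall_notMem fun C hC =>
        hex ⟨C, mem_complementarySet_self.mp hC⟩
      rw [sigma, sigmaCompl, this, Set.ncard_empty]
    rw [hmul 0 (sigma_succ_mul hs fun C hC hj => (hex ⟨C, hC, hj⟩).elim), h0]
    simp

end BilinSpace

theorem mainTheorem11 {K V : Type*} [Field K] [Finite K] [AddCommGroup V] [Module K V]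
    [FiniteDimensional K V] (B : LinearMap.BilinForm K V) (hs : B.IsSymm) (hB : B.Nondegenerate)
    (q n w k : ℕ) (hq : Nat.card K = q) (hn : Module.finrank K V = n)
    (hw : BilinSpace.wittIndex B = w) (hn2 : 2 ≤ n)
    (htype : ¬ BilinSpace.IsTypeN0na B) (hk1 : 1 ≤ k) (hkw : k ≤ w) :
    -- the type of the space is one of the five remaining ones
    (BilinSpace.IsTypeP B ∨ BilinSpace.IsTypeH B ∨ BilinSpace.IsTypeE B ∨
      BilinSpace.IsTypeN0a B ∨ BilinSpace.IsTypeN1 B) ∧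
    -- no subtraction of exponents truncates, because k ≤ w and 2 * w ≤ n
    ((BilinSpace.IsTypeP B ∨ BilinSpace.IsTypeH B ∨ BilinSpace.IsTypeE B) →
      (BilinSpace.sigma B k : ℚ) = BilinSpace.sigma B (k - 1) *
        ((((q : ℚ) ^ (w - k + 1) - 1) * ((q : ℚ) ^ (n - k - w) + 1)) / ((q : ℚ) ^ k - 1))) ∧
    (BilinSpace.IsTypeN0a B →
      (BilinSpace.sigma B k : ℚ) = BilinSpace.sigma B (k - 1) *
        (((q : ℚ) ^ (n - 2 * k + 2) - 1) / ((q : ℚ) ^ k - 1))) ∧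
    (BilinSpace.IsTypeN1 B →
      (BilinSpace.sigma B k : ℚ) = BilinSpace.sigma B (k - 1) *
        (((q : ℚ) ^ (n - 2 * k + 1) - 1) / ((q : ℚ) ^ k - 1))) := by
  subst hq hn hw
  obtain ⟨j, rfl⟩ : ∃ j, k = j + 1 := ⟨k - 1, by omega⟩
  have h2w := BilinSpace.two_mul_wittIndex_le hs hB
  have hq0 : (Nat.card K : ℚ) ≠ 0 := Nat.cast_ne_zero.mpr Nat.card_pos.ne'
  simp only [Nat.add_sub_cancel]
  set n := Module.finrank K V
  set w := BilinSpace.wittIndex B with hwdef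
  refine ⟨?_, fun htyp => ?_, fun htyp => ?_, fun htyp => ?_⟩
  · rcases Nat.even_or_odd (Nat.card K) with hK | hK <;> rcases Nat.even_or_odd n with hn | hn
    · exact Or.inr (Or.inr (Or.inr (Or.inl ⟨hK, hn, by_contra fun h => htype ⟨hK, hn, h⟩⟩)))
    · exact Or.inr (Or.inr (Or.inr (Or.inr ⟨hK, hn⟩)))
    · have h2 := BilinSpace.finrank_le_two_mul_wittIndex_add_two hs hB hK
      obtain ⟨m, hm⟩ := hn
      by_cases h : 2 * w = n
      · exact Or.inr (Or.inl ⟨hK, ⟨m, hm⟩, h⟩)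
      · exact Or.inr (Or.inr (Or.inl ⟨hK, ⟨m, hm⟩, by omega⟩))
    · exact Or.inl ⟨hK, hn⟩
  · have hK : Odd (Nat.card K) := by
      rcases htyp with h | h | h
      exacts [h.1, h.1, h.1]
    refine BilinSpace.sigma_eq_mul_div hs fun C hC hj => ?_
    obtain ⟨U, hCU, hU⟩ := BilinSpace.exists_maximal B hC
    have h := congrArg (Nat.cast (R := ℚ)) (BilinSpace.ncard_isotropic_of_odd hs hB hK hCU hU)
    rw [BilinSpace.finrank_eq_wittIndex hs hB hU, hj, ← hwdef] at h
    push_cast at h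
    -- With `a = w - k` and `b = n - k - w`, every exponent becomes a sum.
    obtain ⟨a, ha⟩ : ∃ a, w = j + 1 + a := ⟨w - (j + 1), by omega⟩
    obtain ⟨b, hb⟩ : ∃ b, n = j + 1 + w + b := ⟨n - (j + 1) - w, by omega⟩
    rw [show Module.finrank K V - w = j + 1 + b by omega,
      show Module.finrank K V - j = (a + 1) + b + j + 1 by omega,
      show (Nat.card K : ℚ) ^ w = (Nat.card K : ℚ) ^ (a + 1 + j) by congr 1; omega] at h
    rw [show w - (j + 1) + 1 = a + 1 by omega, show n - (j + 1) - w = b by omega]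
    refine mul_left_cancel₀ hq0 ?_
    simp only [pow_add] at h ⊢
    linear_combination h
  · refine BilinSpace.sigma_eq_mul_div hs fun C hC hj => ?_
    have : {v | v ∈ B.orthogonal C ∧ B v v = 0} = (B.orthogonal C : Set V) :=
      Set.ext fun v => ⟨fun h => h.1, fun h => ⟨h, htyp.2.2 v⟩⟩
    rw [this, BilinSpace.ncard_orthogonal hB, hj, sub_add_cancel, Nat.cast_pow, ← pow_add]
    congr 1
    omega
  · refine BilinSpace.sigma_eq_mul_div hs fun C hC hj => ?_
    have h := congrArg (Nat.cast (R := ℚ))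
      (BilinSpace.ncard_isotropic_of_even hs hB htyp.1 htyp.2 hC)
    rw [hj] at h
    push_cast at h
    obtain ⟨m, hm⟩ := htyp.2
    refine mul_left_cancel₀ hq0 (h.trans ?_)
    rw [sub_add_cancel, ← pow_add, ← pow_succ']
    congr 1
    omega
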